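/- \textbf{Definitions.} A signed graph $\Sigma$ has a finite node set $V$ and a finite edge set $E$. Multiple edges are allowed. Each edge is a link (two ends, at distinct nodes), a loop (two ends, at the same node), a halfedge (one end) or a loose edge (no ends). Each link and loop, and no other edge, carries a sign $+$ or $-$. For $T\subseteq E$ let $T^c=E\setminus T$, and let $\Sigma|T$ be the subgraph with node set $V$ and edge set $T$. A circle is a connected 2-regular subgraph (a loop is a circle of length 1); its sign is the product of the signs of its edges. A connected component is balanced if it contains no halfedge and all its circles are positive. Let $b(\Sigma|T)$ be the number of balanced components of $\Sigma|T$, where isolated nodes count as components and loose edges are ignored. The bias matroid $G(\Sigma)$ is the matroid on $E$ with rank function $r(T)=|V|-b(\Sigma|T)$; $G^\perp(\Sigma)$ is its dual and $G(\Sigma)|T$ its restriction to $T$. An orientation $\eta$ of $\Sigma$ assigns to each edge end $\varepsilon$ a value $\eta(\varepsilon)\in\{+1,-1\}$ ($+1$ if the arrow on $\varepsilon$ points into the incident node, $-1$ if it points away), so that each link or loop $e$ with ends $\varepsilon_1,\varepsilon_2$ has sign $-\eta(\varepsilon_1)\eta(\varepsilon_2)$. A cycle of an oriented signed graph is a circuit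 $C$ of its bias matroid such that no node incident with an edge of $C$ has all its arrows on edges of $C$ pointing into it, or all of them pointing away from it. An orientation is totally cyclic if every edge belongs to a cycle. Fix an orientation $\eta$ of $\Sigma$, and give each $\Sigma|T$ the restricted orientation when speaking of flows. For $v\in V$, $e\in E$ let $\eta(v,e)$ be the sum of $\eta(\varepsilon)$ over the ends $\varepsilon$ of $e$ incident with $v$. A flow on $\Sigma$ with values in an abelian group $A$ is a function $x:E\to A$ with $\sum_{e\in E}\eta(v,e)\,x(e)=0$ for all $v\in V$; it is nowhere-zero if $x(e)\ne0$ for all $e$. Integral and real flows are those with $A=\mathbb Z$ and $A=\mathbb R$. Let $Z\subseteq\mathbb R^E$ be the space of real flows on $\Sigma$, let $H_e=\{x\in\mathbb R^E: x(e)=0\}$, and let $\mathcal H=\{H_e\cap Z: e\in E,\ H_e\not\supseteq Z\}$ be the arrangement of hyperplanes induced in $Z$ by the coordinate hyperplanes. The flats of $\mathcal H$ are the intersections of subsets of $\mathcal H$ (the empty intersection is $Z$). For a flat $S$ let $E(S)=\{e\in E: S\subseteq H_e\}$. \textbf{Proposition.} Let $\Sigma$ be a signed graph with edge set $E$, with a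 fixed orientation, and let $T\subseteq E$. The following are equivalent: (i) $G(\Sigma)|T$ has no coloops; (ii) $\Sigma|T$ has a totally cyclic orientation; (iii) $\Sigma|T$ has a nowhere-zero integral flow; (iv) $\Sigma|T$ has a nowhere-zero real flow; (v) $T^c$ is closed in $G^\perp(\Sigma)$; (vi) $T=E(S)^c$ for some flat $S$ of $\mathcal H$. -/

import Mathlib

/-- An edge of a signed graph with node set `V`.  An `ordinary` edge has two ends and a sign; it is
a link if its endpoints differ and a loop if they coincide (the order in which the two ends are
listed has no meaning).  A halfedge has one end, a loose edge has no ends; neither has a sign. -/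
inductive SignedEdge (V : Type*) where
  | ordinary (v w : V) (s : ℤˣ)
  | half (v : V)
  | loose

namespace SignedEdge

variable {V : Type*}

/-- The endpoints of an edge, one entry for each end of the edge. -/
def ends : SignedEdge V → List V
  | ordinary v w _ => [v, w]
  | half v => [v]
  | loose => []

/-- The sign of an edge; only links and loops have one. -/
def sign : SignedEdge V → Option ℤˣ
  | ordinary _ _ s => some s
  | half _ => none
  | loose => none

end SignedEdge

/-- A signed graph with node set `V` and edge set `E`; multiple edges, loops, halfedges and loose
edges are allowed. -/
structure SignedGraph (V E : Type*) where
  edge : E → SignedEdge V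

namespace SignedGraph

variable {V E : Type*}

/-- The spanning subgraph `Σ|T` with edge set `T`. -/
def restrict (G : SignedGraph V E) (T : Set E) : SignedGraph V T where
  edge e := G.edge e

/-! ### Components, circles, balance -/

/-- `e` is a link or loop of sign `s` whose endpoints are `v` and `w`. -/
def Joins (G : SignedGraph V E) (e : E) (v w : V) (s : ℤˣ) : Prop :=
  G.edge e = .ordinary v w s ∨ G.edge e = .ordinary w v s

/-- Two nodes are adjacent if some link or loop joins them. -/
def Adj (G : SignedGraph V E) (v w : V) : Prop := ∃ e s, G.Joins e v w s

/-- The equivalence relation on the nodes whose classes are the node sets of the components. -/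
def connSetoid (G : SignedGraph V E) : Setoid V := Relation.EqvGen.setoid G.Adj

/-- The components, ignoring loose edges (an isolated node is a component). -/
def Component (G : SignedGraph V E) : Type _ := Quotient G.connSetoid

/-- The component of a node. -/
def componentOf (G : SignedGraph V E) (v : V) : G.Component := Quotient.mk G.connSetoid v

/-- A circle (connected 2-regular subgraph) of length `k + 1`, traversed once around: distinct nodes
`v 0, …, v k` and distinct edges `e 0, …, e k`, where `e i` has sign `s i` and joins `v i` to
`v (i + 1)`, the indices being taken modulo `k + 1`.  A loop is a circle of length 1. -/
structure IsCircle (G : SignedGraph V E) {k : ℕ} (v : Fin (k + 1) → V) (e : Fin (k + 1) → E)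
    (s : Fin (k + 1) → ℤˣ) : Prop where
  node_injective : Function.Injective v
  edge_injective : Function.Injective e
  joins : ∀ i, G.Joins (e i) (v i) (v (i + 1)) (s i)

/-- A component is balanced if it contains no halfedge and every circle in it has positive sign,
the sign of a circle being the product of the signs of its edges. -/
structure IsBalanced (G : SignedGraph V E) (c : G.Component) : Prop where
  no_half : ∀ e v, G.edge e = .half v → G.componentOf v ≠ c
  circle_pos : ∀ (k : ℕ) (v : Fin (k + 1) → V) (e : Fin (k + 1) → E) (s : Fin (k + 1) → ℤˣ),
    G.IsCircle v e s → G.componentOf (v 0) = c → ∏ i, s i = 1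

/-- `b(Σ)`: the number of balanced components. -/
noncomputable def numBalanced (G : SignedGraph V E) : ℕ :=
  Nat.card {c : G.Component // G.IsBalanced c}

/-- The rank function of the bias matroid, `r(T) = |V| - b(Σ|T)` (always `b(Σ|T) ≤ |V|`). -/
noncomputable def biasRank (G : SignedGraph V E) (T : Set E) : ℕ :=
  Nat.card V - (G.restrict T).numBalanced

/-! ### Orientations, incidence matrix, flows -/

/-- An orientation of a signed graph: `η e i` is `+1` if the arrow on the `i`-th end of `e` points
into the incident node and `-1` if it points away from it; if `e` is a link or loop then its sign is
`- η(ε₁) η(ε₂)`, where `ε₁, ε₂` are its two ends. -/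
structure Orientation (G : SignedGraph V E) where
  η : ∀ e : E, Fin (G.edge e).ends.length → ℤˣ
  sign_eq : ∀ (e : E) (i j : Fin (G.edge e).ends.length), i ≠ j →
    (G.edge e).sign = some (-(η e i * η e j))

namespace Orientation

variable {G : SignedGraph V E}

/-- The orientation of `Σ|T` given by an orientation of `Σ`. -/
def restrict (τ : G.Orientation) (T : Set E) : (G.restrict T).Orientation where
  η e := τ.η e
  sign_eq e := τ.sign_eq e

open Classical in
/-- The entry `η(v, e)` of the incidence matrix: the sum of `η(ε)` over the ends `ε` of `e` that are
incident with `v`. -/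
noncomputable def incidence (τ : G.Orientation) (v : V) (e : E) : ℤ :=
  ∑ i : Fin (G.edge e).ends.length, if (G.edge e).ends.get i = v then (τ.η e i : ℤ) else 0

/-- `x` is a flow with values in the abelian group `A`: at every node `v`, `∑ₑ η(v, e) x(e) = 0`
(a finite sum, since the edge set will be finite). -/
def IsFlow (τ : G.Orientation) {A : Type*} [AddCommGroup A] (x : E → A) : Prop :=
  ∀ v : V, ∑ᶠ e : E, τ.incidence v e • x e = 0

/-- The real cycle space: the null space of the incidence matrix. -/
def cycleSpace [Finite E] (τ : G.Orientation) : Submodule ℝ (E → ℝ) where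
  carrier := {x | τ.IsFlow x}
  zero_mem' := fun v => by simp
  add_mem' := fun {x y} hx hy v => by
    have h := finsum_add_distrib (f := fun e => τ.incidence v e • x e)
      (g := fun e => τ.incidence v e • y e) (Set.toFinite _) (Set.toFinite _)
    rw [hx v, hy v, add_zero] at h
    simpa [smul_add] using h
  smul_mem' := fun c x hx v => by
    have h := smul_finsum c (fun e => τ.incidence v e • x e)
    rw [hx v, smul_zero] at h
    rw [h]
    exact finsum_congr fun e => smul_comm (τ.incidence v e) c (x e)

end Orientation

/-! ### Every signed graph has an orientation -/

theorem nonempty_orientation (G : SignedGraph V E) : Nonempty G.Orientation := by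
  have key : ∀ a : SignedEdge V, ∃ h : Fin a.ends.length → ℤˣ, ∀ i j, i ≠ j →
      a.sign = some (-(h i * h j)) := by
    rintro (⟨v, w, s⟩ | v | _)
    · refine ⟨fun i => if i.1 = 0 then 1 else -s, ?_⟩
      intro ⟨i, hi⟩ ⟨j, hj⟩ hij
      have hij' : i ≠ j := fun h => hij (Fin.ext h)
      simp only [SignedEdge.ends, List.length_cons, List.length_nil] at hi hj
      have h2 : (i = 0 ∧ j = 1) ∨ (i = 1 ∧ j = 0) := by omega
      rcases h2 with ⟨rfl, rfl⟩ | ⟨rfl, rfl⟩ <;> simp [SignedEdge.sign]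
    · refine ⟨fun _ => 1, ?_⟩
      intro ⟨i, hi⟩ ⟨j, hj⟩ hij
      have hij' : i ≠ j := fun h => hij (Fin.ext h)
      simp only [SignedEdge.ends, List.length_cons, List.length_nil] at hi hj
      omega
    · refine ⟨fun _ => 1, ?_⟩
      intro ⟨i, hi⟩
      simp [SignedEdge.ends] at hi
  choose h hh using fun e => key (G.edge e)
  exact ⟨⟨h, hh⟩⟩

/-! ### Walks and balance -/

/-- There is a walk of length `n` and sign `s` from `v` to `w`. -/
inductive Reach (G : SignedGraph V E) : ℕ → V → V → ℤˣ → Prop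
  | nil (v : V) : Reach G 0 v v 1
  | snoc {n : ℕ} {u v w : V} {s t : ℤˣ} {e : E} :
      Reach G n u v s → G.Joins e v w t → Reach G (n + 1) u w (s * t)

theorem Joins.symm {G : SignedGraph V E} {e : E} {v w : V} {s : ℤˣ} (h : G.Joins e v w s) :
    G.Joins e w v s := Or.symm h

theorem Reach.trans {G : SignedGraph V E} {m n : ℕ} {u v w : V} {s t : ℤˣ}
    (h : G.Reach m u v s) (h' : G.Reach n v w t) : G.Reach (m + n) u w (s * t) := by
  induction h' with
  | nil => simpa using h
  | snoc _ hj ih => rw [← mul_assoc]; exact (ih h).snoc hj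

theorem Reach.symm {G : SignedGraph V E} {n : ℕ} {v w : V} {s : ℤˣ}
    (h : G.Reach n v w s) : G.Reach n w v s := by
  induction h with
  | nil v => exact .nil v
  | @snoc n u v w s t e _ hj ih =>
    have h1 : G.Reach (0 + 1) w v (1 * t) := (Reach.nil w).snoc hj.symm
    have h2 := h1.trans ih
    rw [one_mul, mul_comm] at h2
    rwa [show n + 1 = 0 + 1 + n by omega]

theorem componentOf_eq_iff (G : SignedGraph V E) (v w : V) :
    G.componentOf v = G.componentOf w ↔ ∃ n s, G.Reach n v w s := by
  have h0 : G.componentOf v = G.componentOf w ↔ Relation.EqvGen G.Adj v w :=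
    Quotient.eq (r := G.connSetoid)
  rw [h0]
  clear h0
  constructor
  · intro h
    induction h with
    | rel v w h =>
      obtain ⟨e, s, h⟩ := h
      exact ⟨_, _, (Reach.nil v).snoc h⟩
    | refl v => exact ⟨0, 1, .nil v⟩
    | symm v w _ ih => obtain ⟨n, s, h⟩ := ih; exact ⟨n, s, h.symm⟩
    | trans u v w _ _ ih ih' =>
      obtain ⟨n, s, h⟩ := ih
      obtain ⟨n', s', h'⟩ := ih'
      exact ⟨_, _, h.trans h'⟩
  · rintro ⟨n, s, h⟩
    induction h with
    | nil v => exact .refl v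
    | snoc _ hj ih => exact .trans _ _ _ ih (.rel _ _ ⟨_, _, hj⟩)

theorem Reach.exists_fun {G : SignedGraph V E} {n : ℕ} {v w : V} {s : ℤˣ}
    (h : G.Reach n v w s) : ∃ (p : ℕ → V) (t : ℕ → ℤˣ), p 0 = v ∧ p n = w ∧
      (∀ i < n, ∃ e, G.Joins e (p i) (p (i + 1)) (t i)) ∧ s = ∏ i ∈ Finset.range n, t i := by
  induction h with
  | nil v => exact ⟨fun _ => v, fun _ => 1, rfl, rfl, by simp, by simp⟩
  | @snoc n u v w s t e _ hj ih =>
    obtain ⟨p, q, h0, hn, hs, hq⟩ := ih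
    refine ⟨fun i => if i ≤ n then p i else w, fun i => if i < n then q i else t, ?_, ?_, ?_, ?_⟩
    · simpa using h0
    · simp
    · intro i hi
      rcases Nat.lt_succ_iff_lt_or_eq.1 hi with h | rfl
      · have h1 : i ≤ n := h.le
        have h2 : i + 1 ≤ n := h
        simpa [h, h1, h2] using hs i h
      · exact ⟨e, by simpa [hn] using hj⟩
    · rw [Finset.prod_range_succ, hq]
      simp only [lt_self_iff_false, if_false]
      congr 1
      exact Finset.prod_congr rfl fun i hi => by simp [Finset.mem_range.1 hi]

theorem reach_segment {G : SignedGraph V E} {n : ℕ} {p : ℕ → V} {t : ℕ → ℤˣ}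
    (h : ∀ i < n, ∃ e, G.Joins e (p i) (p (i + 1)) (t i)) (i d : ℕ) (hd : i + d ≤ n) :
    G.Reach d (p i) (p (i + d)) (∏ j ∈ Finset.Ico i (i + d), t j) := by
  induction d with
  | zero => simpa using Reach.nil (p i)
  | succ d ih =>
    rw [← add_assoc, Finset.prod_Ico_succ_top (by omega)]
    obtain ⟨e, he⟩ := h (i + d) (by omega)
    exact (ih (by omega)).snoc he

theorem Joins.cases {G : SignedGraph V E} {e : E} {v w v' w' : V} {s s' : ℤˣ}
    (h : G.Joins e v w s) (h' : G.Joins e v' w' s') :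
    s = s' ∧ ((v = v' ∧ w = w') ∨ (v = w' ∧ w = v')) := by
  rcases h with h | h <;> rcases h' with h' | h' <;> rw [h] at h' <;>
    simp only [SignedEdge.ordinary.injEq] at h' <;> tauto

/-- In a component all of whose circles are positive, all closed walks are positive. -/
theorem no_negative_closed {G : SignedGraph V E} {c : G.Component} (hc : G.IsBalanced c) (n : ℕ) :
    ∀ v, G.componentOf v = c → ¬ G.Reach n v v (-1) := by
  induction n using Nat.strong_induction_on with
  | _ n ih =>
  intro v hv hr
  obtain ⟨p, t, h0, hn, hs, hp⟩ := hr.exists_fun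
  rcases n with _ | k
  · simp at hp
  have hcomp : ∀ i ≤ k + 1, G.componentOf (p i) = c := by
    intro i hi
    have := reach_segment hs 0 i (by omega)
    rw [← hv, ← h0]
    rw [zero_add] at this
    exact ((G.componentOf_eq_iff _ _).2 ⟨_, _, this⟩).symm
  -- no repeated node
  have hinj : ∀ i j, i < j → j ≤ k → p i ≠ p j := by
    intro i j hij hjk hpe
    have a := reach_segment hs 0 i (by omega)
    have b := reach_segment hs i (j - i) (by omega)
    have d := reach_segment hs j (k + 1 - j) (by omega)
    rw [show i + (j - i) = j by omega, ← hpe] at b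
    rw [show j + (k + 1 - j) = k + 1 by omega, hn, ← hpe] at d
    rw [zero_add, h0] at a
    have ad := a.trans d
    have hb := ih (j - i) (by omega) (p i) (hcomp i (by omega))
    have had := ih (i + (k + 1 - j)) (by omega) v hv
    rw [Finset.range_eq_Ico, ← Finset.prod_Ico_consecutive t (Nat.zero_le i) (show i ≤ k + 1 by omega),
      ← Finset.prod_Ico_consecutive t (show i ≤ j by omega) (show j ≤ k + 1 by omega)] at hp
    rcases Int.units_eq_one_or (∏ x ∈ Finset.Ico i j, t x) with h1 | h1
    · rw [h1, one_mul] at hp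
      rw [← hp] at ad
      exact had ad
    · rw [h1] at b
      exact hb b
  have hwrap : ∀ i : Fin (k + 1), p (i + 1 : Fin (k + 1)).1 = p (i.1 + 1) := by
    intro i
    rcases eq_or_ne i (Fin.last k) with rfl | hi
    · simp [hn, h0]
    · rw [Fin.val_add_one, if_neg hi]
  have hpinj : Function.Injective (fun i : Fin (k + 1) => p i.1) := by
    intro i j hij
    by_contra hne
    rcases lt_or_gt_of_ne hne with h | h
    · exact hinj i j h (Nat.lt_succ_iff.1 j.2) hij
    · exact hinj j i h (Nat.lt_succ_iff.1 i.2) hij.symm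
  choose e he using fun i : Fin (k + 1) => hs i.1 i.2
  have hj : ∀ i : Fin (k + 1), G.Joins (e i) (p i.1) (p (i + 1 : Fin (k + 1)).1) (t i.1) := by
    intro i; rw [hwrap]; exact he i
  have hprod : ∏ i : Fin (k + 1), t i.1 = -1 := by
    rw [hp, Finset.prod_range]
  have heinj : Function.Injective e := by
    intro i j hij
    by_contra hne
    have h1 := hj i
    rw [hij] at h1
    obtain ⟨hss, h2 | h2⟩ := h1.cases (hj j)
    · exact hne (hpinj h2.1)
    · have h3 : i = j + 1 := hpinj h2.1
      have h4 : i + 1 = j := hpinj h2.2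
      have hi := i.2
      have hj' := j.2
      have hk : k = 1 := by
        have e3 := congrArg Fin.val h3
        have e4 := congrArg Fin.val h4
        rw [Fin.val_add_one] at e3 e4
        have hne' : i.1 ≠ j.1 := fun h => hne (Fin.ext h)
        have l1 : i = Fin.last k ↔ i.1 = k := by rw [Fin.ext_iff]; simp
        have l2 : j = Fin.last k ↔ j.1 = k := by rw [Fin.ext_iff]; simp
        simp only [l1] at e4
        simp only [l2] at e3
        split_ifs at e3 e4 <;> omega
      subst hk
      have ht : t 0 = t 1 := by
        have : (i.1 = 0 ∧ j.1 = 1) ∨ (i.1 = 1 ∧ j.1 = 0) := by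
          have hne' : i.1 ≠ j.1 := fun h => hne (Fin.ext h)
          omega
        rcases this with ⟨a, b⟩ | ⟨a, b⟩
        · rw [a, b] at hss; exact hss
        · rw [a, b] at hss; exact hss.symm
      rw [Fin.prod_univ_two] at hprod
      simp only [Fin.val_zero, Fin.val_one, ht] at hprod
      rcases Int.units_eq_one_or (t 1) with h | h <;> rw [h] at hprod <;> simp at hprod
  have := hc.circle_pos k (fun i => p i.1) e (fun i => t i.1) ⟨hpinj, heinj, hj⟩ (hcomp 0 (by omega))
  rw [hprod] at this
  simp at this

theorem Reach.circle {G : SignedGraph V E} {k : ℕ} {v : Fin (k + 1) → V} {e : Fin (k + 1) → E}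
    {s : Fin (k + 1) → ℤˣ} (h : G.IsCircle v e s) : G.Reach (k + 1) (v 0) (v 0) (∏ i, s i) := by
  have key : ∀ n (hn : n ≤ k), G.Reach n (v 0) (v (Fin.ofNat (k + 1) n))
      (∏ i ∈ Finset.range n, s (Fin.ofNat (k + 1) i)) := by
    intro n
    induction n with
    | zero => intro _; simpa using Reach.nil (v 0)
    | succ n ih =>
      intro hn
      rw [Finset.prod_range_succ]
      have hj := h.joins (Fin.ofNat (k + 1) n)
      have : Fin.ofNat (k + 1) n + 1 = Fin.ofNat (k + 1) (n + 1) := by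
        apply Fin.ext; simp [Fin.val_add]
      rw [this] at hj
      exact (ih (by omega)).snoc hj
  have hj := h.joins (Fin.ofNat (k + 1) k)
  have h1 : Fin.ofNat (k + 1) k = Fin.last k := by apply Fin.ext; simp
  have := (key k le_rfl).snoc hj
  rw [← Finset.prod_range_succ, h1, Fin.last_add_one] at this
  rwa [Finset.prod_range (n := k + 1), show (∏ i : Fin (k + 1), s (Fin.ofNat (k + 1) i.1)) = ∏ i, s i from
    Finset.prod_congr rfl fun i _ => by congr 1; apply Fin.ext; simp] at this

/-! ### The rank of the incidence matrix -/

namespace Orientation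

variable {G : SignedGraph V E}

/-- The columns of the incidence matrix, over the reals. -/
noncomputable def column (τ : G.Orientation) (e : E) : V → ℝ := fun v => τ.incidence v e

theorem sum_incidence [Fintype V] (τ : G.Orientation) (e : E) (f : V → ℝ) :
    ∑ v, τ.column e v * f v =
      ∑ i : Fin (G.edge e).ends.length, ((τ.η e i : ℤ) : ℝ) * f ((G.edge e).ends.get i) := by
  classical
  simp only [column, incidence, Int.cast_sum, Finset.sum_mul]
  rw [Finset.sum_comm]
  refine Finset.sum_congr rfl fun i _ => ?_
  rw [Finset.sum_eq_single ((G.edge e).ends.get i)]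
  · simp
  · intro v _ hv
    rw [if_neg hv.symm]; simp
  · simp

theorem sum_incidence_ordinary [Fintype V] (τ : G.Orientation) {e : E} {v w : V} {s : ℤˣ}
    (h : G.edge e = .ordinary v w s) (f : V → ℝ) :
    ∑ u, τ.column e u * f u = 0 ↔ f w = ((s : ℤ) : ℝ) * f v := by
  rw [sum_incidence]
  have h1 := τ.sign_eq e
  generalize τ.η e = η at h1 ⊢
  revert η
  rw [h]
  intro η h1
  have key : ∀ ζ : Fin 2 → ℤˣ, s = -(ζ 0 * ζ 1) →
      (∑ i : Fin 2, ((ζ i : ℤ) : ℝ) * f ([v, w].get i) = 0 ↔ f w = ((s : ℤ) : ℝ) * f v) := by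
    rintro ζ rfl
    rw [Fin.sum_univ_two]
    change ((ζ 0 : ℤ) : ℝ) * f v + ((ζ 1 : ℤ) : ℝ) * f w = 0 ↔ _
    rcases Int.units_eq_one_or (ζ 0) with a | a <;>
    rcases Int.units_eq_one_or (ζ 1) with b | b <;>
    rw [a, b] <;> push_cast <;> constructor <;> intro h <;> linarith
  exact key η (Option.some.inj (h1 (0 : Fin 2) (1 : Fin 2) (show (0 : Fin 2) ≠ 1 from Fin.zero_ne_one)))

theorem sum_incidence_half [Fintype V] (τ : G.Orientation) {e : E} {v : V}
    (h : G.edge e = .half v) (f : V → ℝ) :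
    ∑ u, τ.column e u * f u = 0 ↔ f v = 0 := by
  rw [sum_incidence]
  generalize τ.η e = η
  revert η
  rw [h]
  intro η
  have h3 : ∑ i : Fin (SignedEdge.half v).ends.length,
      ((η i : ℤ) : ℝ) * f ((SignedEdge.half v).ends.get i) =
      ((η ⟨0, by simp [SignedEdge.ends]⟩ : ℤ) : ℝ) * f v :=
    Fin.sum_univ_one (fun i : Fin 1 => ((η i : ℤ) : ℝ) * f ([v].get i))
  rw [h3]
  rcases Int.units_eq_one_or (η ⟨0, by simp [SignedEdge.ends]⟩) with a | a <;> rw [a] <;> simp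

theorem sum_incidence_loose [Fintype V] (τ : G.Orientation) {e : E}
    (h : G.edge e = .loose) (f : V → ℝ) :
    ∑ u, τ.column e u * f u = 0 := by
  rw [sum_incidence]
  generalize τ.η e = η
  revert η
  rw [h]
  intro η
  exact Fin.sum_univ_zero (fun i : Fin 0 => ((η i : ℤ) : ℝ) * f (([] : List V).get i))

/-- The left null space of the incidence matrix. -/
noncomputable def leftNull [Fintype V] (τ : G.Orientation) : Submodule ℝ (V → ℝ) :=
  LinearMap.ker (Matrix.mulVecLin (Matrix.of τ.column))

theorem mem_leftNull [Fintype V] (τ : G.Orientation) (f : V → ℝ) :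
    f ∈ τ.leftNull ↔ (∀ e v w s, G.Joins e v w s → f w = ((s : ℤ) : ℝ) * f v) ∧
      ∀ e v, G.edge e = .half v → f v = 0 := by
  have h0 : f ∈ τ.leftNull ↔ ∀ e, ∑ u, τ.column e u * f u = 0 := by
    rw [leftNull, LinearMap.mem_ker, Matrix.mulVecLin_apply, funext_iff]
    rfl
  have hs : ∀ s : ℤˣ, ((s : ℤ) : ℝ) * ((s : ℤ) : ℝ) = 1 := by
    intro s
    rcases Int.units_eq_one_or s with h | h <;> simp [h]
  rw [h0]
  constructor
  · intro h
    refine ⟨?_, fun e v he => (τ.sum_incidence_half he f).1 (h e)⟩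
    rintro e v w s (he | he)
    · exact (τ.sum_incidence_ordinary he f).1 (h e)
    · rw [(τ.sum_incidence_ordinary he f).1 (h e), ← mul_assoc, hs, one_mul]
  · rintro ⟨h1, h2⟩ e
    rcases he : G.edge e with ⟨v, w, s⟩ | v | _
    · exact (τ.sum_incidence_ordinary he f).2 (h1 e v w s (.inl he))
    · exact (τ.sum_incidence_half he f).2 (h2 e v he)
    · exact τ.sum_incidence_loose he f

theorem reach_leftNull [Fintype V] (τ : G.Orientation) {f : V → ℝ} (hf : f ∈ τ.leftNull) {n : ℕ}
    {v w : V} {s : ℤˣ} (h : G.Reach n v w s) : f w = ((s : ℤ) : ℝ) * f v := by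
  induction h with
  | nil => simp
  | snoc _ hj ih =>
    rw [((τ.mem_leftNull f).1 hf).1 _ _ _ _ hj, ih]
    push_cast
    ring

theorem leftNull_unbalanced [Fintype V] (τ : G.Orientation) {f : V → ℝ} (hf : f ∈ τ.leftNull)
    (v : V) (hv : ¬ G.IsBalanced (G.componentOf v)) : f v = 0 := by
  have key : ∀ w, G.componentOf w = G.componentOf v → f w = 0 → f v = 0 := by
    intro w hw h0
    obtain ⟨n, s, h⟩ := (G.componentOf_eq_iff _ _).1 hw
    rw [τ.reach_leftNull hf h, h0, mul_zero]
  by_contra hne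
  refine hv ⟨fun e w he hw => hne (key w hw (((τ.mem_leftNull f).1 hf).2 e w he)), ?_⟩
  intro k p e s hc hp
  rcases Int.units_eq_one_or (∏ i, s i) with h | h
  · exact h
  · have h1 := τ.reach_leftNull hf (Reach.circle hc)
    rw [h] at h1
    push_cast at h1
    exact absurd (key _ hp (by linarith)) hne

theorem finrank_leftNull [Fintype V] (τ : G.Orientation) :
    Module.finrank ℝ τ.leftNull = G.numBalanced := by
  classical
  have : Finite G.Component := inferInstanceAs (Finite (Quotient G.connSetoid))
  have : Fintype {c : G.Component // G.IsBalanced c} := Fintype.ofFinite _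
  choose root hroot using fun c : G.Component => Quotient.exists_rep (s := G.connSetoid) c
  replace hroot : ∀ c, G.componentOf (root c) = c := hroot
  choose len sgn hr using fun v : V => (G.componentOf_eq_iff (root (G.componentOf v)) v).1 (hroot _)
  let Φ : τ.leftNull →ₗ[ℝ] ({c : G.Component // G.IsBalanced c} → ℝ) :=
    { toFun := fun f c => f.1 (root c.1)
      map_add' := fun _ _ => rfl
      map_smul' := fun _ _ => rfl }
  have hinj : Function.Injective Φ := by
    rw [injective_iff_map_eq_zero]
    intro f hf
    ext v
    by_cases hb : G.IsBalanced (G.componentOf v)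
    · have h1 : f.1 (root (G.componentOf v)) = 0 := congrFun hf ⟨_, hb⟩
      rw [τ.reach_leftNull f.2 (hr v), h1, mul_zero]
      rfl
    · exact τ.leftNull_unbalanced f.2 v hb
  have hsurj : Function.Surjective Φ := by
    intro h
    have hm : (fun v => if hb : G.IsBalanced (G.componentOf v) then
        ((sgn v : ℤ) : ℝ) * h ⟨_, hb⟩ else 0) ∈ τ.leftNull := by
      rw [mem_leftNull]
      constructor
      · intro e v w s hj
        have hvw : G.componentOf v = G.componentOf w :=
          (G.componentOf_eq_iff _ _).2 ⟨_, _, (Reach.nil v).snoc hj⟩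
        by_cases hb : G.IsBalanced (G.componentOf v)
        · have hb' : G.IsBalanced (G.componentOf w) := hvw ▸ hb
          have hh : h ⟨_, hb'⟩ = h ⟨_, hb⟩ := by congr 2; exact hvw.symm
          simp only [dif_pos hb, dif_pos hb', hh]
          have h1 := ((hr v).snoc hj).trans (hvw ▸ (hr w).symm)
          have h2 := no_negative_closed hb (len v + 1 + len w) _ (hroot _)
          have h3 : sgn v * s * sgn w = 1 := by
            rcases Int.units_eq_one_or (sgn v * s * sgn w) with h | h
            · exact h
            · rw [h] at h1; exact absurd h1 h2
          have h4 : sgn w = s * sgn v := by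
            have := eq_inv_of_mul_eq_one_right h3
            rw [this, mul_inv, Int.units_inv_eq_self, Int.units_inv_eq_self, mul_comm]
          rw [h4]
          push_cast
          ring
        · have hb' : ¬ G.IsBalanced (G.componentOf w) := hvw ▸ hb
          simp [dif_neg hb, dif_neg hb']
      · intro e v he
        exact dif_neg fun hb => hb.no_half e v he rfl
    refine ⟨⟨_, hm⟩, ?_⟩
    ext ⟨c, hc⟩
    have hb : G.IsBalanced (G.componentOf (root c)) := (hroot c).symm ▸ hc
    have hh : h ⟨_, hb⟩ = h ⟨c, hc⟩ := by congr 2; exact hroot c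
    have h1 := hr (root c)
    rw [hroot c] at h1
    have h3 : sgn (root c) = 1 := by
      rcases Int.units_eq_one_or (sgn (root c)) with h | h
      · exact h
      · rw [h] at h1; exact absurd h1 (no_negative_closed hc _ _ (hroot c))
    change (dite _ _ _ : ℝ) = _
    rw [dif_pos hb, hh, h3]
    simp
  rw [(LinearEquiv.ofBijective Φ ⟨hinj, hsurj⟩).finrank_eq, Module.finrank_fintype_fun_eq_card,
    numBalanced, Nat.card_eq_fintype_card]

/-- The rank of the incidence matrix is `|V| - b(Σ)`. -/
theorem finrank_span_column [Finite V] [Finite E] (τ : G.Orientation) :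
    Module.finrank ℝ (Submodule.span ℝ (Set.range τ.column)) + G.numBalanced = Nat.card V := by
  have := Fintype.ofFinite V
  rw [← τ.finrank_leftNull, Nat.card_eq_fintype_card, ← Module.finrank_fintype_fun_eq_card ℝ,
    ← LinearMap.finrank_range_add_finrank_ker (Matrix.mulVecLin (Matrix.of τ.column))]
  congr 1
  exact (Matrix.rank_eq_finrank_span_row (Matrix.of τ.column)).symm

theorem finrank_span_image [Finite V] [Finite E] (τ : G.Orientation) (T : Set E) :
    Module.finrank ℝ (Submodule.span ℝ (τ.column '' T)) = G.biasRank T := by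
  have h := (τ.restrict T).finrank_span_column
  have h2 : Set.range (τ.restrict T).column = τ.column '' T := by
    rw [Set.image_eq_range]
    rfl
  rw [h2] at h
  rw [biasRank]
  omega

theorem linearIndepOn_iff [Finite V] [Finite E] (τ : G.Orientation) (T : Set E) :
    LinearIndepOn ℝ τ.column T ↔ G.biasRank T = T.ncard := by
  have := Fintype.ofFinite T
  rw [← τ.finrank_span_image, ← Nat.card_coe_set_eq, Nat.card_eq_fintype_card, LinearIndepOn,
    linearIndependent_iff_card_eq_finrank_span, Set.finrank, Set.image_eq_range]
  exact eq_comm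

end Orientation

/-! ### The bias matroid -/

/-- The bias matroid `G(Σ)`, the matroid on the edge set with rank function
`r(T) = |V| - b(Σ|T)`: a set `I` of edges is independent if and only if `r(I) = |I|`. -/
noncomputable def biasMatroid [Finite V] [Finite E] (G : SignedGraph V E) : Matroid E :=
  (IndepMatroid.ofFinite (Set.toFinite (Set.univ : Set E)) (fun I => G.biasRank I = I.ncard)
    (by
      obtain ⟨τ⟩ := G.nonempty_orientation
      simp only [← τ.linearIndepOn_iff]
      exact linearIndepOn_empty ℝ _)
    (by
      obtain ⟨τ⟩ := G.nonempty_orientation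
      simp only [← τ.linearIndepOn_iff]
      exact fun I J hJ h => hJ.mono h)
    (by
      obtain ⟨τ⟩ := G.nonempty_orientation
      intro I J hI hJ hlt
      by_contra! hcon
      have hle : Submodule.span ℝ (τ.column '' J) ≤ Submodule.span ℝ (τ.column '' I) := by
        rw [Submodule.span_le]
        rintro _ ⟨e, he, rfl⟩
        by_contra hne
        by_cases heI : e ∈ I
        · exact hne (Submodule.subset_span ⟨e, heI, rfl⟩)
        · refine hcon e he heI ((τ.linearIndepOn_iff _).1 ?_)
          exact ((τ.linearIndepOn_iff _).2 hI).insert hne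
      have := Submodule.finrank_mono hle
      rw [τ.finrank_span_image, τ.finrank_span_image, hI, hJ] at this
      omega)
    (fun I _ => Set.subset_univ I)).matroid

theorem biasMatroid_indep_iff [Finite V] [Finite E] (G : SignedGraph V E) (I : Set E) :
    G.biasMatroid.Indep I ↔ G.biasRank I = I.ncard := Iff.rfl

theorem biasMatroid_ground [Finite V] [Finite E] (G : SignedGraph V E) :
    G.biasMatroid.E = Set.univ := rfl

/-- The rank function of the bias matroid is `T ↦ |V| - b(Σ|T)`. -/
theorem biasMatroid_eRk [Finite V] [Finite E] (G : SignedGraph V E) (T : Set E) :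
    G.biasMatroid.eRk T = G.biasRank T := by
  obtain ⟨τ⟩ := G.nonempty_orientation
  obtain ⟨I, hI⟩ := G.biasMatroid.exists_isBasis T (Set.subset_univ T)
  rw [← hI.encard_eq_eRk, ← (Set.toFinite I).cast_ncard_eq,
    ← (G.biasMatroid_indep_iff I).1 hI.indep, ← τ.finrank_span_image, ← τ.finrank_span_image]
  have hsp : Submodule.span ℝ (τ.column '' I) = Submodule.span ℝ (τ.column '' T) := by
    refine le_antisymm (Submodule.span_mono (Set.image_mono hI.subset)) ?_
    rw [Submodule.span_le]
    rintro _ ⟨e, he, rfl⟩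
    by_contra hne
    have hl := (τ.linearIndepOn_iff I).2 ((G.biasMatroid_indep_iff I).1 hI.indep)
    have hi : G.biasMatroid.Indep (insert e I) :=
      (G.biasMatroid_indep_iff _).2 ((τ.linearIndepOn_iff _).1 (hl.insert hne))
    have heI : e ∈ I := hI.mem_of_insert_indep he hi
    exact hne (Submodule.subset_span ⟨e, heI, rfl⟩)
  rw [hsp]

/-! ### Cycles and totally cyclic orientations -/

namespace Orientation

variable {G : SignedGraph V E}

/-- `C` is a cycle of the oriented signed graph: a circuit of the bias matroid such that no node of
`C` has all its arrows (on ends of edges of `C`) pointing into the node, and none has all its arrows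
pointing away from it. -/
def IsCycle [Finite V] [Finite E] (τ : G.Orientation) (C : Set E) : Prop :=
  G.biasMatroid.IsCircuit C ∧
    ∀ v : V, (∃ e ∈ C, ∃ i, (G.edge e).ends.get i = v) →
      (¬ ∀ e ∈ C, ∀ i, (G.edge e).ends.get i = v → τ.η e i = 1) ∧
      (¬ ∀ e ∈ C, ∀ i, (G.edge e).ends.get i = v → τ.η e i = -1)

/-- An orientation is totally cyclic if every edge belongs to a cycle. -/
def IsTotallyCyclic [Finite V] [Finite E] (τ : G.Orientation) : Prop :=
  ∀ e : E, ∃ C, τ.IsCycle C ∧ e ∈ C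

end Orientation

end SignedGraph

/-! ### Hyperplane arrangements -/

/-- The coordinate hyperplane `H_e = {x | x(e) = 0}` in `ℝ^E`. -/
def coordHyperplane {E : Type*} (e : E) : Submodule ℝ (E → ℝ) :=
  LinearMap.ker (LinearMap.proj e)

/-- The arrangement of all coordinate hyperplanes in `ℝ^E`. -/
def coordArrangement (E : Type*) : Set (Submodule ℝ (E → ℝ)) := Set.range coordHyperplane

/-- The arrangement induced by `𝓗` in the subspace `Z`: all `H ∩ Z` with `H ∈ 𝓗`, `H ⊉ Z`. -/
def inducedArrangement {M : Type*} [AddCommGroup M] [Module ℝ M] (𝓗 : Set (Submodule ℝ M))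
    (Z : Submodule ℝ M) : Set (Submodule ℝ M) :=
  {K | ∃ H ∈ 𝓗, ¬ Z ≤ H ∧ K = H ⊓ Z}

/-- The flats of an arrangement `𝓗` of hyperplanes of the space `Z`: the intersections of
subarrangements, the empty intersection being `Z`. -/
def arrangementFlats {M : Type*} [AddCommGroup M] [Module ℝ M] (Z : Submodule ℝ M)
    (𝓗 : Set (Submodule ℝ M)) : Set (Submodule ℝ M) :=
  {S | ∃ 𝓢 ⊆ 𝓗, S = Z ⊓ sInf 𝓢}

/-- `E(S)`, the set of those `e` for which `H_e` contains `S`. -/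
def coordsVanishing {E : Type*} (S : Submodule ℝ (E → ℝ)) : Set E :=
  {e | S ≤ coordHyperplane e}

/-! The proposition is linear algebra over the incidence matrix of the orientation `η`, whose columns
represent the bias matroid over `ℝ`: a set of edges is dependent exactly when it contains the
support of a nonzero real flow.

An edge that is not a coloop lies in a circuit, hence in the support of a flow; since a real
vector space is not a finite union of proper subspaces, some flow is then nonzero on all edges at
once. A nowhere-zero real flow becomes rational when composed with a `ℚ`-linear functional `ℝ →
ℚ` that is nonzero at its finitely many values, and integral after clearing denominators.

For total cyclicity, reverse the edges on which a given nowhere-zero flow is negative, so that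
the flow becomes positive. Among the nonnegative flows that are nonzero at `e`, one with minimal
support has a circuit as its support (`exists_nonneg_flow_isCircuit`), for otherwise subtracting
a suitable multiple of a flow with smaller support would shrink the support while keeping `e` in
it. The flow condition at a node forbids that all arrows of that circuit enter the node, or that
all leave it (`isCycle_of_nonneg_flow`), so the circuit is a cycle. Conversely an edge of a cycle
lies in a circuit, so it is not a coloop.

The condition on `G^⊥(Σ)` is equivalent to the absence of coloops by the duality of restriction
and contraction. For a flat `S` of the arrangement, a generic point of `S` is a flow with support
`E(S)ᶜ`; conversely, if `T` is the support of a flow, then `S = {x ∈ Z | x(e) = 0 for all e ∉ T}`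
is a flat with `E(S)ᶜ = T`. -/

namespace SignedGraph

variable {V E : Type*} {G : SignedGraph V E}

namespace Orientation

/-! ### Real flows and dependent sets of the bias matroid -/

theorem isFlow_iff_sum_column [Fintype E] (τ : G.Orientation) (x : E → ℝ) :
    τ.IsFlow x ↔ ∑ e, x e • τ.column e = 0 := by
  rw [funext_iff]
  refine forall_congr' fun v => ?_
  rw [finsum_eq_sum_of_fintype, Finset.sum_apply]
  simp [column, mul_comm]

/-- The columns of the incidence matrix represent the bias matroid: the dependent sets are those
containing the support of a nonzero flow. -/
theorem dep_iff_exists_isFlow [Finite V] [Finite E] (τ : G.Orientation) (D : Set E) :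
    G.biasMatroid.Dep D ↔ ∃ x : E → ℝ, τ.IsFlow x ∧ x ≠ 0 ∧ Function.support x ⊆ D := by
  classical
  have := Fintype.ofFinite E
  rw [← Matroid.not_indep_iff (Set.subset_univ D), biasMatroid_indep_iff, ← τ.linearIndepOn_iff,
    linearDepOn_iff]
  simp only [isFlow_iff_sum_column]
  constructor
  · rintro ⟨f, hfD, hf, hne⟩
    refine ⟨f, ?_, fun h => hne (DFunLike.coe_injective h), ?_⟩
    · rw [← hf]
      refine (Finset.sum_subset (Finset.subset_univ _) fun e _ he => ?_).symm
      rw [Finsupp.notMem_support_iff.1 he, zero_smul]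
    · rwa [Finsupp.mem_supported, ← Finsupp.fun_support_eq] at hfD
  · rintro ⟨x, hx, hne, hxD⟩
    refine ⟨Finsupp.equivFunOnFinite.symm x, ?_, ?_, fun h => hne ?_⟩
    · rw [Finsupp.mem_supported, ← Finsupp.fun_support_eq]
      exact hxD
    · rw [← hx]
      refine Finset.sum_subset (Finset.subset_univ _) fun e _ he => ?_
      rw [Finsupp.notMem_support_iff.1 he, zero_smul]
    · ext e
      exact DFunLike.congr_fun h e

/-- Every edge of a circuit is in the support of a flow, as a flow supported on the circuit without
that edge is zero. -/
theorem exists_isFlow_of_mem_isCircuit [Finite V] [Finite E] (τ : G.Orientation) {C : Set E}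
    (hC : G.biasMatroid.IsCircuit C) {e : E} (he : e ∈ C) :
    ∃ x : E → ℝ, τ.IsFlow x ∧ x e ≠ 0 := by
  obtain ⟨x, hx, hne, hxC⟩ := (τ.dep_iff_exists_isFlow C).1 hC.dep
  refine ⟨x, hx, fun h0 => ?_⟩
  have hsub : Function.support x ⊆ C \ {e} := by
    refine Set.subset_sdiff_singleton hxC ?_
    simpa using h0
  exact ((τ.dep_iff_exists_isFlow _).2 ⟨x, hx, hne, hsub⟩).not_indep (hC.sdiff_singleton_indep he)

theorem exists_nowhere_zero_real_flow [Finite V] [Finite E] (τ : G.Orientation)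
    (h : ∀ e, ¬ G.biasMatroid.IsColoop e) : ∃ x : E → ℝ, τ.IsFlow x ∧ ∀ e, x e ≠ 0 := by
  refine Module.Dual.exists_forall_mem_ne_zero_of_forall_exists τ.cycleSpace
    (fun e => LinearMap.proj e) fun e => ?_
  obtain ⟨C, hC, he⟩ := Matroid.exists_mem_isCircuit_of_not_isColoop (Set.mem_univ e) (h e)
  exact τ.exists_isFlow_of_mem_isCircuit hC he

/-! ### Integral flows -/

theorem IsFlow.map [Finite E] {τ : G.Orientation} {A B : Type*} [AddCommGroup A] [AddCommGroup B]
    {x : E → A} (hx : τ.IsFlow x) (f : A →+ B) : τ.IsFlow (fun e => f (x e)) := by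
  intro v
  have h := congrArg f (hx v)
  rw [map_zero, f.map_finsum (Set.toFinite _)] at h
  simpa using h

theorem IsFlow.of_map [Finite E] {τ : G.Orientation} {A B : Type*} [AddCommGroup A]
    [AddCommGroup B] {x : E → A} (f : A →+ B) (hf : Function.Injective f)
    (hx : τ.IsFlow (fun e => f (x e))) : τ.IsFlow x := by
  intro v
  apply hf
  rw [map_zero, f.map_finsum (Set.toFinite _)]
  simpa using hx v

/-- Compose the flow with a `ℚ`-linear functional on `ℝ` that is nonzero at all its values, and
clear denominators. -/
theorem exists_nowhere_zero_integral_flow [Finite E] (τ : G.Orientation) {x : E → ℝ}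
    (hx : τ.IsFlow x) (h0 : ∀ e, x e ≠ 0) : ∃ y : E → ℤ, τ.IsFlow y ∧ ∀ e, y e ≠ 0 := by
  obtain ⟨f, hf⟩ := Module.exists_dual_forall_apply_ne_zero (K := ℚ) x h0
  obtain ⟨b, hb⟩ := IsLocalization.exist_integer_multiples_of_finite (nonZeroDivisors ℤ)
    (fun e => f (x e))
  choose y hy using hb
  refine ⟨y, IsFlow.of_map (Int.castAddHom ℚ) Int.cast_injective ?_, fun e he => ?_⟩
  · have h1 := hx.map ((AddMonoidHom.mulLeft ((b : ℤ) : ℚ)).comp f.toAddMonoidHom)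
    convert h1 using 2 with e
    simpa using hy e
  · have h1 := hy e
    rw [he, map_zero, eq_comm, smul_eq_zero] at h1
    exact h1.elim (nonZeroDivisors.coe_ne_zero b) (hf e)

/-! ### Nonnegative flows and cycles -/

theorem support_ssubset_of_subset {x y : E → ℝ} (h : Function.support y ⊆ Function.support x)
    {e : E} (hx : x e ≠ 0) (hy : y e = 0) : Function.support y ⊂ Function.support x :=
  h.ssubset_of_mem_notMem hx (by simpa using hy)

/-- Subtracting from a nonnegative flow `z` the largest admissible multiple of a flow `w` whose
support is contained in that of `z` makes the support smaller; coordinates at which `w` is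
nonpositive are not lost. -/
theorem exists_nonneg_flow_support_ssubset [Finite E] (τ : G.Orientation) {z w : E → ℝ}
    (hz : τ.IsFlow z) (hw : τ.IsFlow w) (hz0 : ∀ e, 0 ≤ z e)
    (hwz : Function.support w ⊆ Function.support z) {f : E} (hf : 0 < w f) :
    ∃ y : E → ℝ, τ.IsFlow y ∧ (∀ e, 0 ≤ y e) ∧ Function.support y ⊂ Function.support z ∧
      ∀ e, z e ≠ 0 → w e ≤ 0 → y e ≠ 0 := by
  -- `g` minimizes the ratio `z / w` over the edges at which `w` is positive.
  obtain ⟨g, hg, hmin⟩ := Set.exists_min_image {e | 0 < w e} (fun e => z e / w e)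
    (Set.toFinite _) ⟨f, hf⟩
  have ht : 0 ≤ z g / w g := div_nonneg (hz0 g) (le_of_lt hg)
  have hflow : τ.IsFlow (z - (z g / w g) • w) :=
    τ.cycleSpace.sub_mem hz (τ.cycleSpace.smul_mem _ hw)
  refine ⟨z - (z g / w g) • w, hflow, fun e => ?_, ?_, fun e he hwe => ?_⟩
  · simp only [Pi.sub_apply, Pi.smul_apply, smul_eq_mul, sub_nonneg]
    rcases lt_or_ge 0 (w e) with h | h
    · exact (le_div_iff₀ h).1 (hmin e h)
    · exact (mul_nonpos_of_nonneg_of_nonpos ht h).trans (hz0 e)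
  · refine support_ssubset_of_subset (e := g) (fun e he => ?_) (hwz (ne_of_gt hg)) ?_
    · rw [Function.mem_support] at he ⊢
      intro h
      have hwe : w e = 0 := by
        by_contra hne
        exact hwz hne h
      simp [h, hwe] at he
    · simp [div_mul_cancel₀ (z g) (ne_of_gt hg)]
  · have h1 : 0 < z e := lt_of_le_of_ne (hz0 e) he.symm
    have h2 := mul_nonpos_of_nonneg_of_nonpos ht hwe
    simp only [Pi.sub_apply, Pi.smul_apply, smul_eq_mul]
    linarith

/-- A nonnegative flow of minimal support among those that are nonzero at `e` is supported on a
circuit. -/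
theorem exists_nonneg_flow_isCircuit [Finite V] [Finite E] (τ : G.Orientation) {x : E → ℝ}
    (hx : τ.IsFlow x) (hx0 : ∀ e, 0 ≤ x e) {e : E} (he : x e ≠ 0) :
    ∃ z : E → ℝ, τ.IsFlow z ∧ (∀ e, 0 ≤ z e) ∧ z e ≠ 0 ∧
      G.biasMatroid.IsCircuit (Function.support z) := by
  obtain ⟨C, ⟨z, hz, hz0, hze, rfl⟩, hmin⟩ := Set.exists_min_image
    {C | ∃ z : E → ℝ, τ.IsFlow z ∧ (∀ e, 0 ≤ z e) ∧ z e ≠ 0 ∧ C = Function.support z} Set.ncard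
    (Set.toFinite _) ⟨_, x, hx, hx0, he, rfl⟩
  have hmin' : ∀ y : E → ℝ, τ.IsFlow y → (∀ e, 0 ≤ y e) → y e ≠ 0 →
      ¬ Function.support y ⊂ Function.support z := by
    intro y hy hy0 hye hss
    exact (hmin _ ⟨y, hy, hy0, hye, rfl⟩).not_gt (Set.ncard_lt_ncard hss)
  -- No flow with support smaller than `z` and nonpositive at `e` has a positive coordinate.
  have key : ∀ w : E → ℝ, τ.IsFlow w → Function.support w ⊂ Function.support z → w e ≤ 0 →
      ∀ f, w f ≤ 0 := by
    intro w hw hss hwe f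
    by_contra! hf
    obtain ⟨y, hy, hy0, hys, hye⟩ :=
      τ.exists_nonneg_flow_support_ssubset hz hw hz0 hss.subset hf
    exact hmin' y hy hy0 (hye e hze hwe) hys
  refine ⟨z, hz, hz0, hze, Matroid.isCircuit_iff_forall_ssubset.2
    ⟨(τ.dep_iff_exists_isFlow _).2 ⟨z, hz, fun h => hze (congrFun h e), subset_rfl⟩, ?_⟩⟩
  intro I hI
  by_contra hdep
  rw [Matroid.not_indep_iff (Set.subset_univ I), τ.dep_iff_exists_isFlow] at hdep
  -- Replace the dependency by its negative if necessary, to make it nonpositive at `e`.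
  obtain ⟨w, hw, hne, hwz, hwe⟩ : ∃ w : E → ℝ, τ.IsFlow w ∧ w ≠ 0 ∧
      Function.support w ⊂ Function.support z ∧ w e ≤ 0 := by
    obtain ⟨w, hw, hne, hwI⟩ := hdep
    have hwz := hwI.trans_ssubset hI
    rcases le_total (w e) 0 with h | h
    · exact ⟨w, hw, hne, hwz, h⟩
    · refine ⟨-w, τ.cycleSpace.neg_mem hw, neg_ne_zero.2 hne, ?_, by simpa using h⟩
      rwa [Function.support_neg]
  have hneg : τ.IsFlow (-w) := τ.cycleSpace.neg_mem hw
  have hnegz : Function.support (-w) ⊂ Function.support z := by rwa [Function.support_neg]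
  have hle := key w hw hwz hwe
  have hwe0 : w e = 0 := by
    by_contra h
    exact hmin' (-w) hneg (fun f => by simpa using hle f) (by simpa using h) hnegz
  refine hne (funext fun f => le_antisymm (hle f) ?_)
  simpa using key (-w) hneg hnegz (by simp [hwe0]) f

open Classical in
/-- If all arrows on ends of `e` at `v` have the same direction `σ`, then `η(v, e)` is `σ` times the
number of these ends. -/
theorem incidence_eq_mul_card (τ : G.Orientation) {v : V} {e : E} {σ : ℤˣ}
    (h : ∀ i, (G.edge e).ends.get i = v → τ.η e i = σ) :
    τ.incidence v e = σ * (Finset.univ.filter fun i => (G.edge e).ends.get i = v).card := by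
  rw [incidence, Finset.card_filter, Nat.cast_sum, Finset.mul_sum]
  refine Finset.sum_congr rfl fun i _ => ?_
  split_ifs with hi
  · simp [h i hi]
  · simp

/-- The support of a nonnegative flow has no source and no sink. -/
theorem not_forall_eq_of_nonneg_flow [Finite E] (τ : G.Orientation) {z : E → ℝ} (hz : τ.IsFlow z)
    (hz0 : ∀ e, 0 ≤ z e) {v : V} {e : E} (he : z e ≠ 0) {i : Fin (G.edge e).ends.length}
    (hi : (G.edge e).ends.get i = v) (σ : ℤˣ) :
    ¬ ∀ e ∈ Function.support z, ∀ i, (G.edge e).ends.get i = v → τ.η e i = σ := by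
  classical
  intro h
  have := Fintype.ofFinite E
  let c : E → ℝ := fun e => (Finset.univ.filter fun i => (G.edge e).ends.get i = v).card
  have h1 : ∀ e, τ.incidence v e • z e = ((σ : ℤ) : ℝ) * (c e * z e) := by
    intro e
    by_cases hze : z e = 0
    · simp [hze]
    · rw [τ.incidence_eq_mul_card (h e hze), zsmul_eq_mul, ← mul_assoc]
      push_cast
      rfl
  have h2 := hz v
  rw [finsum_eq_sum_of_fintype, Finset.sum_congr rfl fun e _ => h1 e, ← Finset.mul_sum] at h2
  have hσ : ((σ : ℤ) : ℝ) ≠ 0 := by exact_mod_cast σ.ne_zero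
  have h3 := (Finset.sum_eq_zero_iff_of_nonneg fun e _ =>
    mul_nonneg (Nat.cast_nonneg _) (hz0 e)).1 ((mul_eq_zero.1 h2).resolve_left hσ) e
      (Finset.mem_univ e)
  have h4 : c e ≠ 0 := Nat.cast_ne_zero.2 (Finset.card_ne_zero_of_mem
    (Finset.mem_filter.2 ⟨Finset.mem_univ i, hi⟩))
  exact mul_ne_zero h4 he h3

theorem isCycle_of_nonneg_flow [Finite V] [Finite E] (τ : G.Orientation) {z : E → ℝ}
    (hz : τ.IsFlow z) (hz0 : ∀ e, 0 ≤ z e)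
    (hC : G.biasMatroid.IsCircuit (Function.support z)) : τ.IsCycle (Function.support z) := by
  refine ⟨hC, ?_⟩
  rintro v ⟨e, he, i, hi⟩
  exact ⟨τ.not_forall_eq_of_nonneg_flow hz hz0 he hi 1,
    τ.not_forall_eq_of_nonneg_flow hz hz0 he hi (-1)⟩

/-! ### Totally cyclic orientations -/

/-- The orientation obtained by multiplying all arrows of each edge `e` by `σ e`. -/
def reorient (τ : G.Orientation) (σ : E → ℤˣ) : G.Orientation where
  η e i := σ e * τ.η e i
  sign_eq e i j hij := by
    rw [τ.sign_eq e i j hij, mul_mul_mul_comm, Int.units_mul_self, one_mul]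

theorem incidence_reorient (τ : G.Orientation) (σ : E → ℤˣ) (v : V) (e : E) :
    (τ.reorient σ).incidence v e = σ e * τ.incidence v e := by
  classical
  rw [incidence, incidence, Finset.mul_sum]
  refine Finset.sum_congr rfl fun i _ => ?_
  simp [reorient]

theorem IsFlow.reorient {τ : G.Orientation} {x : E → ℝ} (hx : τ.IsFlow x) (σ : E → ℤˣ) :
    (τ.reorient σ).IsFlow fun e => ((σ e : ℤ) : ℝ) * x e := by
  intro v
  rw [← hx v]
  refine finsum_congr fun e => ?_
  rw [incidence_reorient]
  rcases Int.units_eq_one_or (σ e) with h | h <;> simp [h]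

theorem exists_isTotallyCyclic [Finite V] [Finite E] (τ : G.Orientation) {x : E → ℝ}
    (hx : τ.IsFlow x) (h0 : ∀ e, x e ≠ 0) : ∃ τ' : G.Orientation, τ'.IsTotallyCyclic := by
  let σ : E → ℤˣ := fun e => if 0 < x e then 1 else -1
  have hpos : ∀ e, 0 < ((σ e : ℤ) : ℝ) * x e := by
    intro e
    by_cases h : 0 < x e
    · simp [σ, h]
    · simp [σ, h, lt_of_le_of_ne (not_lt.1 h) (h0 e)]
  refine ⟨τ.reorient σ, fun e => ?_⟩
  obtain ⟨z, hz, hz0, hze, hC⟩ := (τ.reorient σ).exists_nonneg_flow_isCircuit (hx.reorient σ)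
    (fun e => (hpos e).le) (hpos e).ne'
  exact ⟨_, (τ.reorient σ).isCycle_of_nonneg_flow hz hz0 hC, hze⟩

/-! ### Restriction to a set of edges -/

theorem isFlow_restrict_iff (τ : G.Orientation) {T : Set E} {x : E → ℝ}
    (hx : Function.support x ⊆ T) :
    (τ.restrict T).IsFlow (fun e : T => x e) ↔ τ.IsFlow x := by
  refine forall_congr' fun v => ?_
  have h1 : ∑ᶠ e : T, (τ.restrict T).incidence v e • x e =
      ∑ᶠ e ∈ T, τ.incidence v e • x e :=
    finsum_set_coe_eq_finsum_mem (f := fun e => τ.incidence v e • x e) T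
  rw [h1, finsum_mem_def, Set.indicator_eq_self.2]
  exact (Function.support_smul_subset_right (fun e => τ.incidence v e) x).trans hx

theorem exists_nowhere_zero_restrict_iff (τ : G.Orientation) (T : Set E) :
    (∃ x : T → ℝ, (τ.restrict T).IsFlow x ∧ ∀ e, x e ≠ 0) ↔
      ∃ x : E → ℝ, τ.IsFlow x ∧ Function.support x = T := by
  classical
  constructor
  · rintro ⟨x, hx, h0⟩
    let y : E → ℝ := fun e => if h : e ∈ T then x ⟨e, h⟩ else 0
    have hy : Function.support y = T := by
      ext e
      by_cases h : e ∈ T <;> simp [y, h, h0]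
    refine ⟨y, (τ.isFlow_restrict_iff hy.subset).1 ?_, hy⟩
    convert hx using 2 with e
    simp [y]
  · rintro ⟨x, hx, rfl⟩
    exact ⟨fun e => x e, (τ.isFlow_restrict_iff subset_rfl).2 hx, fun e => e.2⟩

end Orientation

theorem biasMatroid_restrict [Finite V] [Finite E] (G : SignedGraph V E) (T : Set E) :
    (G.restrict T).biasMatroid = G.biasMatroid.restrictSubtype T := by
  obtain ⟨τ⟩ := G.nonempty_orientation
  refine Matroid.ext_indep (by rw [Matroid.restrictSubtype_ground, biasMatroid_ground])
    fun I _ => ?_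
  rw [Matroid.restrictSubtype_indep_iff, biasMatroid_indep_iff, biasMatroid_indep_iff,
    ← τ.linearIndepOn_iff, ← (τ.restrict T).linearIndepOn_iff]
  exact linearIndependent_equiv' (Equiv.Set.image _ I Subtype.val_injective) rfl

theorem forall_not_isColoop_restrict_iff [Finite V] [Finite E] (G : SignedGraph V E) (T : Set E) :
    (∀ e : E, ¬ (G.biasMatroid.restrict T).IsColoop e) ↔
      ∀ e : T, ¬ (G.restrict T).biasMatroid.IsColoop e := by
  have h : ∀ e : T, (G.biasMatroid.restrict T).IsColoop e ↔
      (G.restrict T).biasMatroid.IsColoop e := by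
    intro e
    rw [biasMatroid_restrict, ← Matroid.map_val_restrictSubtype_eq, Matroid.IsColoop,
      Matroid.map_dual]
    refine Matroid.map_isLoop_iff (M := (G.biasMatroid.restrictSubtype T).dual) ?_
    rw [Matroid.dual_ground, Matroid.restrictSubtype_ground]
    exact Set.mem_univ e
  refine ⟨fun hc e he => hc e ((h e).2 he), fun hc e he => ?_⟩
  exact hc ⟨e, he.mem_ground⟩ ((h _).1 he)

end SignedGraph

/-! ### Flats -/

theorem Matroid.dual_isFlat_compl_iff {α : Type*} (M : Matroid α) {T : Set α} (hT : T ⊆ M.E) :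
    M.dual.IsFlat (M.E \ T) ↔ ∀ e, ¬ (M.restrict T).IsColoop e := by
  have h : ∀ e, (M.restrict T).IsColoop e ↔ e ∈ M.dual.closure (M.E \ T) ∧ e ∉ M.E \ T := by
    intro e
    rw [← Matroid.contract_isLoop_iff_mem_closure, ← Matroid.dual_delete, Matroid.delete_compl hT]
    rfl
  simp only [h, not_and, not_not]
  rw [Matroid.isFlat_iff_closure_eq]
  exact ⟨fun hc e he => hc ▸ he, fun hc => subset_antisymm hc
    (M.dual.subset_closure _ Set.sdiff_subset)⟩

/-- The sets `E(S)ᶜ` for the flats `S` of the arrangement induced by the coordinate hyperplanes are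
the supports of the vectors of the subspace. -/
theorem exists_arrangementFlats_iff {E : Type*} [Finite E] (Z : Submodule ℝ (E → ℝ)) (T : Set E) :
    (∃ S ∈ arrangementFlats Z (inducedArrangement (coordArrangement E) Z),
      T = (coordsVanishing S)ᶜ) ↔ ∃ x ∈ Z, Function.support x = T := by
  constructor
  · rintro ⟨S, ⟨𝓢, -, rfl⟩, rfl⟩
    -- A generic point of the flat `S` lies on no hyperplane that does not contain `S`.
    obtain ⟨x, hxS, hx⟩ := Module.Dual.exists_forall_mem_ne_zero_of_forall_exists (Z ⊓ sInf 𝓢)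
      (fun e : ((coordsVanishing (Z ⊓ sInf 𝓢))ᶜ : Set E) =>
        (LinearMap.proj (e : E) : (E → ℝ) →ₗ[ℝ] ℝ))
      (fun e => SetLike.not_le_iff_exists.1 (show ¬ _ ≤ coordHyperplane (e : E) from e.2))
    refine ⟨x, hxS.1, Set.ext fun e => ⟨fun he hv => he (hv hxS), fun he => hx ⟨e, he⟩⟩⟩
  · rintro ⟨x, hx, rfl⟩
    let 𝓢 : Set (Submodule ℝ (E → ℝ)) :=
      {K | ∃ e, x e = 0 ∧ ¬ Z ≤ coordHyperplane e ∧ K = coordHyperplane e ⊓ Z}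
    refine ⟨_, ⟨𝓢, ?_, rfl⟩, Set.ext fun e => ?_⟩
    · rintro K ⟨e, -, he, rfl⟩
      exact ⟨_, ⟨e, rfl⟩, he, rfl⟩
    · rw [Function.mem_support, Set.mem_compl_iff, not_iff_not]
      refine ⟨fun he => ?_, fun he => he (Submodule.mem_inf.2 ⟨hx, ?_⟩)⟩
      · by_cases hZ : Z ≤ coordHyperplane e
        · exact inf_le_left.trans hZ
        · have hK : coordHyperplane e ⊓ Z ∈ 𝓢 := ⟨e, he, hZ, rfl⟩
          exact inf_le_right.trans ((sInf_le hK).trans inf_le_left)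
      · rw [Submodule.mem_sInf]
        rintro K ⟨f, hf, -, rfl⟩
        exact ⟨hf, hx⟩

/-- `G` is the signed graph `Σ`, `η` a fixed orientation of it (which defines the incidence matrix,
hence flows and the real cycle space), `T` a set of edges. -/
theorem propositionL {V E : Type*} [Finite V] [Finite E] (G : SignedGraph V E)
    (η : G.Orientation) (T : Set E) :
    List.TFAE [
      ∀ e : E, ¬ (G.biasMatroid.restrict T).IsColoop e,
      ∃ τ : (G.restrict T).Orientation, τ.IsTotallyCyclic,
      ∃ x : T → ℤ, (η.restrict T).IsFlow x ∧ ∀ e, x e ≠ 0,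
      ∃ x : T → ℝ, (η.restrict T).IsFlow x ∧ ∀ e, x e ≠ 0,
      G.biasMatroid.dual.IsFlat Tᶜ,
      ∃ S ∈ arrangementFlats η.cycleSpace (inducedArrangement (coordArrangement E) η.cycleSpace),
        T = (coordsVanishing S)ᶜ ] := by
  tfae_have 1 → 4 := fun h => (η.restrict T).exists_nowhere_zero_real_flow
    ((G.forall_not_isColoop_restrict_iff T).1 h)
  tfae_have 4 → 3 := fun ⟨_, hx, h0⟩ => (η.restrict T).exists_nowhere_zero_integral_flow hx h0
  tfae_have 3 → 4 := fun ⟨x, hx, h0⟩ =>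
    ⟨fun e => x e, hx.map (Int.castAddHom ℝ), fun e => Int.cast_ne_zero.2 (h0 e)⟩
  tfae_have 4 → 2 := fun ⟨_, hx, h0⟩ => (η.restrict T).exists_isTotallyCyclic hx h0
  tfae_have 2 → 1 := by
    rintro ⟨τ, hτ⟩
    rw [G.forall_not_isColoop_restrict_iff]
    intro e
    obtain ⟨C, hC, he⟩ := hτ e
    exact hC.1.not_isColoop_of_mem he
  tfae_have 5 ↔ 1 := by
    rw [Set.compl_eq_univ_sdiff]
    exact G.biasMatroid.dual_isFlat_compl_iff (Set.subset_univ T)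
  tfae_have 4 ↔ 6 :=
    (η.exists_nowhere_zero_restrict_iff T).trans (exists_arrangementFlats_iff η.cycleSpace T).symm
  tfae_finish
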